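/- Let $w,s,h,m_1,\dots,m_s$ be positive integers with $w<h+m_1+\cdots+m_s$, and let $W$ be a set of $w$ wagons. A position is a sequence $p=(W_0,W_1,\dots,W_s)$ of pairwise disjoint ordered subsets of $W$ (finite sequences of distinct wagons) whose union is $W$, with $|W_0|\le h$ and $|W_i|\le m_i$ for $1\le i\le s$. Here $W_0$ lists the wagons in the headshunt from the shunting engine to the points, and $W_i$ lists the wagons in Siding $i$ from the points to the buffer stop. The inglenook graph has the positions as vertices; two distinct positions $(W_0,\dots,W_s)$ and $(W'_0,\dots,W'_s)$ are adjacent (form a move) if and only if for some $r\in\{1,\dots,s\}$ we have $W_i=W'_i$ for all $i\in\{1,\dots,s\}\setminus\{r\}$ and the concatenation of $W_0$ and $W_r$ equals the concatenation of $W'_0$ and $W'_r$. Let $S$ and $F$ be nonempty sets of positions (the starting and finishing positions) that are natural, meaning that 1. $S$ is closed under permuting the wagons: if $p\in S$, then every position obtained from $p$ by applying a permutation of $W$ to the wagons also lies in $S$; 2. there are $z\in\{1,\dots,s\}$ and $\omega\in W$ such that in every position of $F$ the last wagon (nearest the buffer stop) of Siding $z$ is $\omega$. The puzzle can always be solved if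 from every $p\in S$ there is a path in the inglenook graph to some position in $F$. Consider the inequality $$h-1+m_1+m_2+\cdots+m_s\ \ge\ w+\max\{h-1,m_1,m_2,\dots,m_s\}.\qquad(*)$$ **Theorem.** The puzzle can always be solved if and only if one of the following holds: - $w=1$; - $w>1$, $s>1$, $h>1$ and $(*)$; - $w>1$, $s>2$, $h=1$ and $(*)$. -/

import Mathlib

namespace Inglenook

/-- A position `(W₀, W₁, …, W_s)` of the inglenook puzzle with set of wagons `W`, headshunt length `h`
and `s` sidings of lengths `m 0, …, m (s - 1)`. Ordered subsets of `W` are lists without repetition.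
The headshunt is listed from the shunting engine to the points, each siding from the points to the
buffer stop. -/
@[ext]
structure Position (W : Type*) {s : ℕ} (h : ℕ) (m : Fin s → ℕ) where
  /-- the wagons in the headshunt, from shunting engine to points -/
  headshunt : List W
  /-- the wagons in each siding, from points to buffer stop -/
  siding : Fin s → List W
  headshunt_nodup : headshunt.Nodup
  siding_nodup : ∀ i, (siding i).Nodup
  /-- every wagon is in the headshunt or in a siding -/
  cover : ∀ a : W, a ∈ headshunt ∨ ∃ i, a ∈ siding i
  headshunt_disjoint : ∀ i, List.Disjoint headshunt (siding i)
  siding_disjoint : ∀ i j, i ≠ j → List.Disjoint (siding i) (siding j)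
  headshunt_length_le : headshunt.length ≤ h
  siding_length_le : ∀ i, (siding i).length ≤ m i

variable {W : Type*} {s : ℕ} {h : ℕ} {m : Fin s → ℕ}

/-- The pair `(p, q)` is a move: the positions are distinct and, for some siding `r`, all other
sidings agree and the headshunt followed by siding `r` is the same list of wagons in `p` and `q`. -/
def IsMove (p q : Position W h m) : Prop :=
  p ≠ q ∧ ∃ r : Fin s, (∀ i, i ≠ r → p.siding i = q.siding i) ∧
    p.headshunt ++ p.siding r = q.headshunt ++ q.siding r

theorem IsMove.symm {p q : Position W h m} (hpq : IsMove p q) : IsMove q p := by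
  obtain ⟨hne, r, h1, h2⟩ := hpq
  exact ⟨hne.symm, r, fun i hi => (h1 i hi).symm, h2.symm⟩

/-- The inglenook graph: vertices are the positions, edges are the moves. -/
def graph (W : Type*) {s : ℕ} (h : ℕ) (m : Fin s → ℕ) : SimpleGraph (Position W h m) where
  Adj := IsMove
  symm := ⟨fun _ _ hpq => hpq.symm⟩
  loopless := ⟨fun _ hp => hp.1 rfl⟩

/-- The position obtained from `p` by permuting the wagons amongst themselves. -/
def Position.permute (σ : Equiv.Perm W) (p : Position W h m) : Position W h m where
  headshunt := p.headshunt.map σ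
  siding i := (p.siding i).map σ
  headshunt_nodup := p.headshunt_nodup.map σ.injective
  siding_nodup i := (p.siding_nodup i).map σ.injective
  cover a := by
    rcases p.cover (σ.symm a) with ha | ⟨i, ha⟩
    · exact Or.inl (List.mem_map.2 ⟨_, ha, σ.apply_symm_apply a⟩)
    · exact Or.inr ⟨i, List.mem_map.2 ⟨_, ha, σ.apply_symm_apply a⟩⟩
  headshunt_disjoint i := List.disjoint_map σ.injective (p.headshunt_disjoint i)
  siding_disjoint i j hij := List.disjoint_map σ.injective (p.siding_disjoint i j hij)
  headshunt_length_le := by simpa using p.headshunt_length_le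
  siding_length_le i := by simpa using p.siding_length_le i

/-- A set of starting positions is natural if it is closed under permuting the wagons. -/
def IsNaturalStart (S : Set (Position W h m)) : Prop :=
  ∀ p ∈ S, ∀ σ : Equiv.Perm W, p.permute σ ∈ S

/-- A set of finishing positions is natural if, for some siding `z`, all its positions have the same
wagon as the last wagon (nearest the buffer stop) in siding `z`. -/
def IsNaturalFinish (F : Set (Position W h m)) : Prop :=
  ∃ (z : Fin s) (ω : W), ∀ p ∈ F, (p.siding z).getLast? = some ω

/-- The puzzle with starting positions `S` and finishing positions `F` can always be solved: from
every starting position there is a path in the inglenook graph to a finishing position. -/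
def AlwaysSolvable (S F : Set (Position W h m)) : Prop :=
  ∀ p ∈ S, ∃ q ∈ F, (graph W h m).Reachable p q

/-- The inequality `h - 1 + m₁ + ⋯ + m_s ≥ w + max {h - 1, m₁, …, m_s}` (used only for `1 ≤ h`). -/
def MainCondition {s : ℕ} (w h : ℕ) (m : Fin s → ℕ) : Prop :=
  (h - 1) + ∑ i, m i ≥ w + max (h - 1) (Finset.univ.sup m)

end Inglenook

/-! Sufficiency: read the headshunt from the points, so that it and the sidings become stacks, and
keep one headshunt place free for transit. A wagon can then pass from the top of any stack to the
top of any other with room, the capacities being h - 1 and the mᵢ. The inequality (*) says that all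
wagons still fit when any one stack is left out, and the bounds on s and h give three stacks of
positive capacity. Under these conditions all arrangements are connected
(`stackReach_of_content_eq`): bring a wagon to the bottom of a largest stack in both arrangements,
freeze it there, and induct with that capacity reduced by one.

Necessity: if the condition fails and w > 1, some wagon is determined by the position, unchanged by
moves, and carried along by permutations. Permuting the start gives it any desired identity, whereas
ending siding z with ω either forces it to be ω or forbids it (`not_alwaysSolvable_of_invariant`).
The wagon is the one nearest the engine, the one nearest the buffer stop of a longest siding, or one
at an end of the track when the order along the track is fixed. -/

namespace Inglenook

open Function

/-! ### Rearranging stacks of bounded capacity. -/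

section Stacks

variable {ι W : Type*} [DecidableEq ι] {c : ι → ℕ} {T T' : ι → List W}

/-- A move of the top element of one stack to the top of a stack, for stacks with capacities `c`;
here `U` is what remains when the moving element is ignored. -/
def StackStep (c : ι → ℕ) (T T' : ι → List W) : Prop :=
  ∃ (U : ι → List W) (i j : ι) (a : W), (U i).length < c i ∧ (U j).length < c j ∧
    T = update U i (a :: U i) ∧ T' = update U j (a :: U j)

/-- Reachability by moves of single elements between stacks. -/
abbrev StackReach (c : ι → ℕ) : (ι → List W) → (ι → List W) → Prop :=
  Relation.ReflTransGen (StackStep c)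

theorem StackStep.symm (hT : StackStep c T T') : StackStep c T' T := by
  obtain ⟨U, i, j, a, hi, hj, h1, h2⟩ := hT
  exact ⟨U, j, i, a, hj, hi, h2, h1⟩

theorem StackReach.symm (hT : StackReach c T T') : StackReach c T' T :=
  have : Std.Symm (StackStep (W := W) c) := ⟨fun _ _ h => h.symm⟩
  Std.Symm.symm _ _ hT

theorem StackStep.length_le (hT : StackStep c T T') (hb : ∀ k, (T k).length ≤ c k) (k : ι) :
    (T' k).length ≤ c k := by
  obtain ⟨U, i, j, a, hi, hj, rfl, rfl⟩ := hT
  have hU : (U k).length ≤ c k := by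
    have := hb k
    by_cases hk : k = i
    · subst hk; exact hi.le
    · simpa [hk] using this
  by_cases hk : k = j
  · subst hk; simpa using hj
  · simpa [hk] using hU

theorem StackReach.length_le (hT : StackReach c T T') (hb : ∀ k, (T k).length ≤ c k) :
    ∀ k, (T' k).length ≤ c k := by
  induction hT with
  | refl => exact hb
  | tail _ h ih => exact h.length_le ih

/-- The multiset of all elements of the stacks. -/
def content [Fintype ι] (T : ι → List W) : Multiset W := ∑ i, (T i : Multiset W)

theorem card_content {ι W : Type*} [Fintype ι] (T : ι → List W) :
    Multiset.card (content T) = ∑ i, (T i).length := by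
  simp [content]

theorem eq_nil_of_card_content_eq_zero {ι W : Type*} [Fintype ι] {T : ι → List W}
    (hT : Multiset.card (content T) = 0) : T = fun _ => [] := by
  rw [card_content, Finset.sum_eq_zero_iff] at hT
  exact funext fun i => List.eq_nil_of_length_eq_zero (hT i (Finset.mem_univ i))

theorem mem_content {ι W : Type*} [Fintype ι] {T : ι → List W} {a : W} : a ∈ content T ↔ ∃ i, a ∈ T i := by
  simp [content, Multiset.mem_sum]

theorem content_update_cons [Fintype ι] (T : ι → List W) (i : ι) (a : W) :
    content (update T i (a :: T i)) = a ::ₘ content T := by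
  unfold content
  rw [← Finset.add_sum_erase _ _ (Finset.mem_univ i),
    ← Finset.add_sum_erase _ (fun k => (T k : Multiset W)) (Finset.mem_univ i)]
  have : ∑ x ∈ Finset.univ.erase i, ((update T i (a :: T i) x : List W) : Multiset W) =
      ∑ x ∈ Finset.univ.erase i, (T x : Multiset W) :=
    Finset.sum_congr rfl fun x hx => by simp [Finset.ne_of_mem_erase hx]
  rw [this, update_self, ← Multiset.cons_coe, Multiset.cons_add]

theorem content_update_concat [Fintype ι] (T : ι → List W) (i : ι) (a : W) :
    content (update T i (T i ++ [a])) = a ::ₘ content T := by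
  rw [← content_update_cons T i a]
  refine Finset.sum_congr rfl fun k _ => ?_
  by_cases hk : k = i
  · subst hk
    simp only [update_self]
    exact Multiset.coe_eq_coe.2 (List.perm_append_singleton a _)
  · simp [hk]

theorem StackReach.content_eq [Fintype ι] (hT : StackReach c T T') : content T = content T' := by
  induction hT with
  | refl => rfl
  | tail _ h ih =>
    obtain ⟨U, i, j, a, hi, hj, rfl, rfl⟩ := h
    rw [ih, content_update_cons, content_update_cons]

theorem exists_stackReach_cons (hb : ∀ k, (T k).length ≤ c k) {i j : ι} (hij : i ≠ j) {a : W}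
    {l : List W} (hi : T i = a :: l) (hj : (T j).length < c j) :
    ∃ T', StackReach c T T' ∧ T' i = l ∧ T' j = a :: T j ∧ ∀ k, k ≠ i → k ≠ j → T' k = T k := by
  have hbi := hb i
  refine ⟨update (update T i l) j (a :: T j), .single ⟨update T i l, i, j, a, ?_, ?_, ?_, ?_⟩,
    ?_, ?_, ?_⟩
  · rw [hi] at hbi; simpa using hbi
  · simpa [hij.symm] using hj
  · simp [← hi]
  · simp [hij.symm]
  · simp [hij]
  · simp
  · intro k h1 h2; simp [h1, h2]

theorem exists_stackReach_append (L : List W) (hb : ∀ k, (T k).length ≤ c k) {i j : ι}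
    (hij : i ≠ j) {X : List W} (hi : T i = L ++ X) (hj : L.length + (T j).length ≤ c j) :
    ∃ T', StackReach c T T' ∧ T' i = X ∧ T' j = L.reverse ++ T j ∧
      ∀ k, k ≠ i → k ≠ j → T' k = T k := by
  induction L generalizing T with
  | nil => exact ⟨T, .refl, by simpa using hi, by simp, fun _ _ _ => rfl⟩
  | cons a L ih =>
    rw [List.length_cons] at hj
    obtain ⟨T₁, r₁, i₁, j₁, k₁⟩ := exists_stackReach_cons hb hij (a := a) (l := L ++ X)
      (by simpa using hi) (by omega)
    obtain ⟨T₂, r₂, i₂, j₂, k₂⟩ := ih (r₁.length_le hb) i₁ (by rw [j₁, List.length_cons]; omega)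
    exact ⟨T₂, r₁.trans r₂, i₂, by simp [j₂, j₁], fun k h1 h2 => by rw [k₂ k h1 h2, k₁ k h1 h2]⟩

/-- A stack can be emptied if the other stacks have enough room. -/
theorem exists_stackReach_empty [Fintype ι] (z : ι) (hb : ∀ k, (T k).length ≤ c k)
    (hc : Multiset.card (content T) + c z ≤ ∑ i, c i) : ∃ T', StackReach c T T' ∧ T' z = [] := by
  induction hl : T z generalizing T with
  | nil => exact ⟨T, .refl, hl⟩
  | cons a l ih =>
    -- If every other stack were full, the nonempty stack `z` would bring the content above `∑ i, c
    -- i - c z`.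
    obtain ⟨j, hjz, hj⟩ : ∃ j, j ≠ z ∧ (T j).length < c j := by
      by_contra! hcon
      rw [card_content, ← Finset.add_sum_erase _ _ (Finset.mem_univ z),
        ← Finset.add_sum_erase _ c (Finset.mem_univ z), hl, List.length_cons] at hc
      have := Finset.sum_le_sum (s := Finset.univ.erase z)
        fun j hj => hcon j (Finset.ne_of_mem_erase hj)
      omega
    obtain ⟨T₁, r₁, i₁, -, -⟩ := exists_stackReach_cons hb hjz.symm hl hj
    obtain ⟨T₂, r₂, h₂⟩ := ih (r₁.length_le hb) (by rwa [← r₁.content_eq]) i₁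
    exact ⟨T₂, r₁.trans r₂, h₂⟩

/-- Any element `ω` can be brought to the bottom of a stack `z` of maximal capacity. -/
theorem exists_stackReach_bottom [Fintype ι] {z : ι} (hz : ∀ k, c k ≤ c z)
    (hb : ∀ k, (T k).length ≤ c k) (hc : Multiset.card (content T) + c z ≤ ∑ i, c i)
    (h3 : 2 ≤ Multiset.card (content T) → ∀ i j, ∃ k, k ≠ i ∧ k ≠ j ∧ 0 < c k)
    {ω : W} (hω : ω ∈ content T) : ∃ T', StackReach c T T' ∧ T' z = [ω] := by
  obtain ⟨T₀, r₀, z₀⟩ := exists_stackReach_empty z hb hc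
  have b₀ := r₀.length_le hb
  rw [r₀.content_eq] at hω h3
  obtain ⟨j, hj⟩ := mem_content.1 hω
  have hjz : j ≠ z := by rintro rfl; simp [z₀] at hj
  obtain ⟨L, X, hLX⟩ := List.append_of_mem hj
  have hlen := b₀ j
  rw [hLX] at hlen
  simp only [List.length_append, List.length_cons] at hlen
  have hzj := hz j
  -- Maximality of `c z` makes the segment down to `ω` fit into the empty stack `z`. This leaves `ω`
  -- on top of the reversed `L`.
  obtain ⟨T₁, r₁, j₁, z₁, k₁⟩ := exists_stackReach_append (L ++ [ω]) b₀ hjz (X := X)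
    (by simp [hLX]) (by rw [z₀]; simp; omega)
  have b₁ := r₁.length_le b₀
  rw [z₀] at z₁
  rcases L.eq_nil_or_concat with rfl | ⟨L', b, hL'⟩
  · exact ⟨T₁, r₀.trans r₁, by simpa using z₁⟩
  have hLpos : 0 < L.length := by simp [hL']
  obtain ⟨k, hkz, hkj, hk⟩ := h3 (by
    rw [card_content]
    refine le_trans ?_ (Finset.single_le_sum (f := fun i => (T₀ i).length)
      (fun _ _ => Nat.zero_le _) (Finset.mem_univ j))
    simp only [hLX, List.length_append, List.length_cons]
    omega) z j
  -- Make room for `ω` on the third stack `k`. If `k` is full, its top goes to `j`, which has just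
  -- lost at least two elements; even then `L` will fit back, in the place that `ω` gave up.
  obtain ⟨T₂, r₂, z₂, j₂, k₂⟩ : ∃ T₂, StackReach c T₁ T₂ ∧ T₂ z = ω :: L.reverse ∧
      (T₂ j).length ≤ X.length + 1 ∧ (T₂ k).length < c k := by
    by_cases hkl : (T₁ k).length < c k
    · exact ⟨T₁, .refl, by simpa using z₁, by simp [j₁], hkl⟩
    · obtain ⟨b, Y, hY⟩ : ∃ b Y, T₁ k = b :: Y := by
        cases h : T₁ k with
        | nil => simp [h] at hkl; omega
        | cons b Y => exact ⟨b, Y, rfl⟩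
      obtain ⟨T₂, r₂, k₂, j₂, z₂⟩ := exists_stackReach_cons b₁ hkj hY (by rw [j₁]; omega)
      refine ⟨T₂, r₂, ?_, ?_, ?_⟩
      · rw [z₂ z hkz.symm hjz.symm, z₁]; simp
      · simp [j₂, j₁]
      · have := b₁ k
        rw [hY] at this
        rw [k₂]
        simpa using this
  have b₂ := r₂.length_le b₁
  -- Park `ω` on `k`, return `L` to `j`, then drop `ω` into the empty `z`.
  obtain ⟨T₃, r₃, z₃, k₃, j₃⟩ := exists_stackReach_cons b₂ hkz.symm z₂ k₂
  have b₃ := r₃.length_le b₂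
  obtain ⟨T₄, r₄, z₄, j₄, k₄⟩ := exists_stackReach_append L.reverse b₃ hjz.symm (X := [])
    (by simp [z₃]) (by rw [j₃ j hjz hkj.symm, List.length_reverse]; omega)
  have b₄ := r₄.length_le b₃
  obtain ⟨T₅, r₅, -, z₅, -⟩ := exists_stackReach_cons b₄ hkz (a := ω) (l := T₂ k)
    (by rw [k₄ k hkz hkj, k₃]) (by rw [z₄]; simp; omega)
  exact ⟨T₅, r₀.trans (r₁.trans (r₂.trans (r₃.trans (r₄.trans r₅)))), by rw [z₅, z₄]⟩

/-- A frozen element at the bottom of `z` costs one place and otherwise does not interfere; this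
lifts the inductive solution back. -/
theorem StackReach.concat {z : ι} (ω : W)
    (hT : StackReach (update c z (c z - 1)) T T') :
    StackReach c (update T z (T z ++ [ω])) (update T' z (T' z ++ [ω])) := by
  have key : ∀ (U : ι → List W) (i : ι) (a : W),
      update (update U i (a :: U i)) z (update U i (a :: U i) z ++ [ω]) =
        update (update U z (U z ++ [ω])) i (a :: update U z (U z ++ [ω]) i) := by
    intro U i a
    by_cases h : i = z
    · subst h; simp
    · rw [update_comm h, update_of_ne (Ne.symm h), update_of_ne h]
  have len : ∀ (U : ι → List W) (i : ι), (U i).length < update c z (c z - 1) i →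
      (update U z (U z ++ [ω]) i).length < c i := by
    intro U i h
    by_cases hi : i = z
    · subst hi; simp at h ⊢; omega
    · simpa [hi] using h
  refine hT.lift (fun T => update T z (T z ++ [ω])) ?_
  rintro _ _ ⟨U, i, j, a, hi, hj, rfl, rfl⟩
  exact ⟨update U z (U z ++ [ω]), i, j, a, len U i hi, len U j hj, key U i a, key U j a⟩

/-- All arrangements of the same elements are connected if the other stacks can together hold all
elements when any one stack is left out, and there are at least three stacks of positive capacity or
at most one element. -/
theorem stackReach_of_content_eq [Fintype ι] (w : ℕ) (hb : ∀ k, (T k).length ≤ c k)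
    (hb' : ∀ k, (T' k).length ≤ c k) (hTT' : content T = content T')
    (hw : Multiset.card (content T) = w) (hc : ∀ j, w + c j ≤ ∑ i, c i)
    (h3 : 2 ≤ w → ∀ i j, ∃ k, k ≠ i ∧ k ≠ j ∧ 0 < c k) : StackReach c T T' := by
  induction w generalizing c T T' with
  | zero =>
    rw [eq_nil_of_card_content_eq_zero hw, eq_nil_of_card_content_eq_zero (T := T') (hTT' ▸ hw)]
  | succ w ih =>
    obtain ⟨ω, hω⟩ := Multiset.card_pos_iff_exists_mem.1 (show 0 < Multiset.card (content T) by omega)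
    obtain ⟨i₀, -⟩ := mem_content.1 hω
    obtain ⟨z, -, hz⟩ := Finset.exists_max_image Finset.univ c ⟨i₀, Finset.mem_univ _⟩
    replace hz : ∀ k, c k ≤ c z := fun k => hz k (Finset.mem_univ k)
    obtain ⟨T₁, r₁, z₁⟩ := exists_stackReach_bottom hz hb (hw ▸ hc z) (hw ▸ h3) hω
    obtain ⟨T₂, r₂, z₂⟩ := exists_stackReach_bottom hz hb' (hTT' ▸ hw ▸ hc z) (hTT' ▸ hw ▸ h3)
      (hTT' ▸ hω)
    have b₁ := r₁.length_le hb
    have b₂ := r₂.length_le hb'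
    have hcz : 0 < c z := by have := b₁ z; rw [z₁] at this; exact this
    have strip : ∀ U : ι → List W, U z = [ω] →
        update (update U z []) z (update U z [] z ++ [ω]) = U := by
      intro U hU; simp [← hU]
    have bstrip : ∀ U : ι → List W, (∀ k, (U k).length ≤ c k) → ∀ k,
        (update U z [] k).length ≤ update c z (c z - 1) k := by
      intro U hU k
      by_cases hk : k = z
      · subst hk; simp
      · simpa [hk] using hU k
    have e₁ := content_update_concat (update T₁ z []) z ω
    have e₂ := content_update_concat (update T₂ z []) z ω
    rw [strip T₁ z₁] at e₁
    rw [strip T₂ z₂] at e₂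
    have hsum : ∑ i, update c z (c z - 1) i + 1 = ∑ i, c i := by
      rw [← Finset.add_sum_erase _ _ (Finset.mem_univ z),
        ← Finset.add_sum_erase _ c (Finset.mem_univ z), update_self,
        Finset.sum_congr rfl fun x hx => update_of_ne (Finset.ne_of_mem_erase hx) _ _]
      omega
    have hle : ∀ j, update c z (c z - 1) j ≤ c j := by
      intro j
      by_cases hj : j = z
      · subst hj; simp
      · simp [hj]
    have hc' : ∀ j, w + update c z (c z - 1) j ≤ ∑ i, update c z (c z - 1) i := by
      intro j; have := hc j; have := hle j; omega
    have key : StackReach (update c z (c z - 1)) (update T₁ z []) (update T₂ z []) := by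
      refine ih (bstrip T₁ b₁) (bstrip T₂ b₂) ?_ ?_ hc' ?_
      · rw [← Multiset.cons_inj_right ω, ← e₁, ← e₂, ← r₁.content_eq, ← r₂.content_eq, hTT']
      · have := congrArg Multiset.card e₁
        rw [← r₁.content_eq, hw, Multiset.card_cons] at this
        omega
      · intro hw2 i j
        obtain ⟨k, hki, hkj, hk⟩ := h3 (by omega) i j
        by_contra! hcon
        -- Only `z` lost capacity, so a missing third stack must be `z`, now of capacity 0. All
        -- original capacities are then at most 1, while leaving out `i` forces `w ≤ c j ≤ 1`.
        have hkz : k = z := by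
          by_contra hkz
          have := hcon k hki hkj
          simp [hkz] at this
          omega
        subst hkz
        have h1 := hcon k hki hkj
        have h2 : ∑ x, update c k (c k - 1) x ≤
            update c k (c k - 1) i + update c k (c k - 1) j := by
          refine le_trans (Finset.sum_le_sum_of_ne_zero (t := {i, j}) ?_) ?_
          · intro x _ hx
            by_contra hx'
            simp only [Finset.mem_insert, Finset.mem_singleton, not_or] at hx'
            have := hcon x hx'.1 hx'.2
            omega
          · by_cases hij : i = j
            · subst hij; simp
            · rw [Finset.sum_pair hij]
        have h4 := hc' i
        have h5 := hle j
        have h6 := hz j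
        simp only [update_self] at h1
        omega
    have key' := key.concat ω
    rw [strip T₁ z₁, strip T₂ z₂] at key'
    exact r₁.trans (key'.trans r₂.symm)

end Stacks

end Inglenook

/-! ### Positions as stacks, and stack steps as moves. -/

namespace Inglenook

variable {W : Type*} {s : ℕ} {h : ℕ} {m : Fin s → ℕ}

open Function

namespace Position

/-- The headshunt, read from the points, and the sidings as stacks indexed by `Option (Fin s)`. -/
def toStacks (p : Position W h m) (o : Option (Fin s)) : List W :=
  o.elim p.headshunt.reverse p.siding

@[simp] theorem toStacks_none (p : Position W h m) : p.toStacks none = p.headshunt.reverse := rfl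

@[simp] theorem toStacks_some (p : Position W h m) (i : Fin s) :
    p.toStacks (some i) = p.siding i := rfl

theorem toStacks_injective : Injective (toStacks : Position W h m → _) := by
  intro p q hpq
  refine Position.ext ?_ (funext fun i => congrFun hpq (some i))
  exact List.reverse_injective (congrFun hpq none)

theorem nodup_toStacks (p : Position W h m) (i : Option (Fin s)) : (p.toStacks i).Nodup := by
  cases i with
  | none => exact List.nodup_reverse.2 p.headshunt_nodup
  | some i => exact p.siding_nodup i

theorem exists_mem_toStacks (p : Position W h m) (a : W) : ∃ i, a ∈ p.toStacks i := by
  rcases p.cover a with ha | ⟨i, ha⟩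
  · exact ⟨none, List.mem_reverse.2 ha⟩
  · exact ⟨some i, ha⟩

theorem eq_of_mem_toStacks (p : Position W h m) {a : W} {i j : Option (Fin s)}
    (hi : a ∈ p.toStacks i) (hj : a ∈ p.toStacks j) : i = j := by
  cases i with
  | none => cases j with
    | none => rfl
    | some j => exact (p.headshunt_disjoint j (List.mem_reverse.1 hi) hj).elim
  | some i => cases j with
    | none => exact (p.headshunt_disjoint i (List.mem_reverse.1 hj) hi).elim
    | some j =>
      by_contra hij
      exact p.siding_disjoint i j (fun e => hij (congrArg some e)) hi hj

theorem content_toStacks [Fintype W] (p : Position W h m) :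
    content p.toStacks = Finset.univ.val := by
  classical
  ext a
  obtain ⟨i, hi⟩ := p.exists_mem_toStacks a
  rw [content, Multiset.count_sum', Multiset.count_univ, Finset.sum_eq_single i]
  · rw [Multiset.coe_count]
    exact List.count_eq_one_of_mem (p.nodup_toStacks i) hi
  · intro j _ hj
    rw [Multiset.coe_count]
    exact List.count_eq_zero.2 fun hja => hj (p.eq_of_mem_toStacks hja hi)
  · simp

theorem card_content_toStacks [Fintype W] (p : Position W h m) :
    Multiset.card (content p.toStacks) = Fintype.card W := by
  rw [content_toStacks]; rfl

theorem length_add_sum_length [Fintype W] (p : Position W h m) :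
    p.headshunt.length + ∑ i, (p.siding i).length = Fintype.card W := by
  rw [← p.card_content_toStacks, card_content, Fintype.sum_option]
  simp

/-- Having every wagon exactly once in the total content encodes absence of repetition, disjointness
and covering together. -/
theorem exists_toStacks_eq [Fintype W] {T : Option (Fin s) → List W}
    (hT : content T = Finset.univ.val) (h0 : (T none).length ≤ h)
    (hm : ∀ i, (T (some i)).length ≤ m i) : ∃ p : Position W h m, p.toStacks = T := by
  classical
  have hcount : ∀ a, ∑ i, (T i).count a = 1 := by
    intro a
    have := congrArg (Multiset.count a) hT
    rw [content, Multiset.count_sum', Multiset.count_univ] at this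
    simpa only [Multiset.coe_count] using this
  have hnodup : ∀ i, (T i).Nodup := fun i => List.nodup_iff_count_le_one.2 fun a =>
    (Finset.single_le_sum (f := fun i => (T i).count a) (fun _ _ => Nat.zero_le _)
      (Finset.mem_univ i)).trans (hcount a).le
  have hdisj : ∀ i j, i ≠ j → List.Disjoint (T i) (T j) := by
    intro i j hij a hi hj
    have h1 := Finset.sum_le_sum_of_subset (f := fun i => (T i).count a)
      (Finset.subset_univ {i, j})
    rw [hcount, Finset.sum_pair hij] at h1
    have h2 := List.count_pos_iff.2 hi
    have h3 := List.count_pos_iff.2 hj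
    omega
  have hcover : ∀ a, ∃ i, a ∈ T i := fun a => mem_content.1 (by rw [hT]; simp)
  refine ⟨⟨(T none).reverse, fun i => T (some i), List.nodup_reverse.2 (hnodup none),
    fun i => hnodup _, ?_, ?_, ?_, by simpa using h0, hm⟩, ?_⟩
  · intro a
    obtain ⟨_ | i, hi⟩ := hcover a
    · exact Or.inl (List.mem_reverse.2 hi)
    · exact Or.inr ⟨i, hi⟩
  · intro i a ha hi
    exact hdisj none (some i) (by simp) (List.mem_reverse.1 ha) hi
  · intro i j hij
    exact hdisj (some i) (some j) (by simpa using hij)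
  · funext i
    cases i with
    | none => exact List.reverse_reverse _
    | some i => rfl

/-- A wagon on top of some stack can be moved to a headshunt that is not full. -/
theorem exists_reachable_headshunt [Fintype W] (p : Position W h m) (hh : 0 < h)
    {U : Option (Fin s) → List W} {i : Option (Fin s)} {a : W}
    (hp : p.toStacks = update U i (a :: U i)) (hU : (U none).length ≤ h - 1) :
    ∃ q : Position W h m, q.toStacks = update U none (a :: U none) ∧ (graph W h m).Reachable p q := by
  cases i with
  | none => exact ⟨p, hp, .refl p⟩
  | some r =>
    obtain ⟨q, hq⟩ := exists_toStacks_eq (h := h) (m := m) (T := update U none (a :: U none))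
      (by rw [← p.content_toStacks, hp, content_update_cons, content_update_cons])
      (by simp; omega)
      (by
        intro i
        have h1 := p.siding_length_le i
        have h2 := congrFun hp (some i)
        rw [toStacks_some] at h2
        by_cases hi : i = r
        · subst hi
          rw [h2] at h1
          simp at h1 ⊢
          omega
        · rw [h2] at h1
          simpa [hi] using h1)
    refine ⟨q, hq, ?_⟩
    by_cases hpq : p = q
    · subst hpq; exact .refl _
    · refine SimpleGraph.Adj.reachable (show IsMove p q from ⟨hpq, r, ?_, ?_⟩)
      · intro i hi
        rw [← toStacks_some p, ← toStacks_some q, hp, hq]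
        simp [hi]
      · have h1 : p.headshunt = (U none).reverse := by
          rw [← List.reverse_reverse p.headshunt, ← toStacks_none, hp]
          simp
        have h2 : q.headshunt = (a :: U none).reverse := by
          rw [← List.reverse_reverse q.headshunt, ← toStacks_none, hq]
          simp
        rw [← toStacks_some p, ← toStacks_some q, h1, h2, hp, hq]
        simp

/-- Both ends of a step reach the same position, with the moving wagon in the spare headshunt place;
moves are reversible. -/
theorem exists_reachable_of_stackStep [Fintype W] (p : Position W h m) (hh : 0 < h)
    {T : Option (Fin s) → List W}
    (hb : ∀ k : Option (Fin s), (p.toStacks k).length ≤ k.elim (h - 1) m)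
    (hT : StackStep (fun k => k.elim (h - 1) m) p.toStacks T) :
    ∃ q : Position W h m, q.toStacks = T ∧ (graph W h m).Reachable p q := by
  have hb' := hT.length_le hb
  have hc := (StackReach.content_eq (.single hT)).symm.trans p.content_toStacks
  obtain ⟨U, i, j, a, hi, hj, hp, rfl⟩ := hT
  have hU : (U none).length ≤ h - 1 := by
    have := hb none
    rw [hp] at this
    cases i with
    | none => simp at this; simp; omega
    | some i => simpa using this
  obtain ⟨q, hq⟩ := exists_toStacks_eq (h := h) (m := m) hc ((hb' none).trans (Nat.sub_le h 1))
    fun i => hb' (some i)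
  obtain ⟨p', hp', rp⟩ := p.exists_reachable_headshunt hh hp hU
  obtain ⟨q', hq', rq⟩ := q.exists_reachable_headshunt hh hq hU
  rw [toStacks_injective (hq'.trans hp'.symm)] at rq
  exact ⟨q, hq, rp.trans rq.symm⟩

theorem reachable_of_stackReach [Fintype W] (p q : Position W h m) (hh : 0 < h)
    (hb : ∀ k : Option (Fin s), (p.toStacks k).length ≤ k.elim (h - 1) m)
    (hT : StackReach (fun k => k.elim (h - 1) m) p.toStacks q.toStacks) :
    (graph W h m).Reachable p q := by
  suffices ∀ T, StackReach (fun k : Option (Fin s) => k.elim (h - 1) m) p.toStacks T →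
      ∃ q : Position W h m, q.toStacks = T ∧ (graph W h m).Reachable p q by
    obtain ⟨q', hq', r⟩ := this _ hT
    rwa [toStacks_injective hq'] at r
  intro T hT
  induction hT with
  | refl => exact ⟨p, rfl, .refl p⟩
  | tail hT hstep ih =>
    obtain ⟨q, rfl, r⟩ := ih
    obtain ⟨q', hq', r'⟩ := q.exists_reachable_of_stackStep hh (StackReach.length_le hT hb) hstep
    exact ⟨q', hq', r.trans r'⟩

/-- If the sidings can hold all wagons, a place in the headshunt can be vacated. -/
theorem exists_reachable_headshunt_length_le [Fintype W] (p : Position W h m) (hh : 0 < h)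
    (hw : Fintype.card W ≤ ∑ i, m i) :
    ∃ q : Position W h m, (graph W h m).Reachable p q ∧
      ∀ k : Option (Fin s), (q.toStacks k).length ≤ k.elim (h - 1) m := by
  by_cases hp : p.headshunt.length ≤ h - 1
  · refine ⟨p, .refl p, ?_⟩
    rintro (_ | i)
    · simpa using hp
    · exact p.siding_length_le i
  · obtain ⟨r, hr⟩ : ∃ r, (p.siding r).length < m r := by
      by_contra! hcon
      have h1 := Finset.sum_le_sum (s := Finset.univ) fun i _ => hcon i
      have h2 := p.length_add_sum_length
      omega
    obtain ⟨a, l, hal⟩ : ∃ a l, p.headshunt.reverse = a :: l := by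
      cases hl : p.headshunt.reverse with
      | nil => rw [List.reverse_eq_nil_iff] at hl; simp [hl] at hp
      | cons a l => exact ⟨a, l, rfl⟩
    have hl : l.length ≤ h - 1 := by
      have h1 := congrArg List.length hal
      rw [List.length_reverse, List.length_cons] at h1
      have h2 := p.headshunt_length_le
      omega
    have hpU : p.toStacks = update (update p.toStacks none l) none
        (a :: update p.toStacks none l none) := by simp [← hal, ← toStacks_none]
    have hb : ∀ i, (update (update p.toStacks none l) (some r)
        (a :: update p.toStacks none l (some r)) (some i)).length ≤ m i := by
      intro i
      by_cases hi : i = r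
      · subst hi; simpa using hr
      · simpa [hi] using p.siding_length_le i
    obtain ⟨q, hq⟩ := exists_toStacks_eq (h := h) (m := m)
      (T := update (update p.toStacks none l) (some r) (a :: update p.toStacks none l (some r)))
      (by rw [content_update_cons, ← content_update_cons _ none, ← hpU, p.content_toStacks])
      (by simp; omega) hb
    -- Moving `a` back from siding `r` of `q` recovers `p`.
    obtain ⟨q', hq', r'⟩ := q.exists_reachable_headshunt hh hq (by simpa using hl)
    rw [toStacks_injective (hq'.trans hpU.symm)] at r'
    refine ⟨q, r'.symm, ?_⟩
    rw [hq]
    rintro (_ | i)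
    · simpa using hl
    · exact hb i

end Position

/-! ### Sufficiency. -/

open Position

/-- Under the main inequality, the inglenook graph is connected. -/
theorem reachable_of_mainCondition [Fintype W] (hh : 0 < h) (hm : ∀ i, 0 < m i)
    (hs : (1 < s ∧ 1 < h) ∨ 2 < s) (hc : MainCondition (Fintype.card W) h m)
    (p q : Position W h m) : (graph W h m).Reachable p q := by
  unfold MainCondition at hc
  have hsum : ∑ k : Option (Fin s), k.elim (h - 1) m = h - 1 + ∑ i, m i := by
    rw [Fintype.sum_option]; rfl
  obtain ⟨p', rp, bp⟩ := p.exists_reachable_headshunt_length_le hh (by omega)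
  obtain ⟨q', rq, bq⟩ := q.exists_reachable_headshunt_length_le hh (by omega)
  refine rp.trans ((reachable_of_stackReach p' q' hh bp ?_).trans rq.symm)
  refine stackReach_of_content_eq (Fintype.card W) bp bq
    (p'.content_toStacks.trans q'.content_toStacks.symm) p'.card_content_toStacks ?_ ?_
  · rw [hsum]
    rintro (_ | i)
    · simp only [Option.elim_none]; omega
    · have : m i ≤ Finset.univ.sup m := Finset.le_sup (Finset.mem_univ i)
      simp only [Option.elim_some]; omega
  · intro _ i j
    by_contra! hcon
    -- Otherwise at most two stacks have positive capacity, contradicting the bounds on `s` and `h`.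
    have hsub : (Finset.univ.filter fun k : Option (Fin s) => 0 < k.elim (h - 1) m) ⊆ {i, j} := by
      intro k hk
      by_contra hk'
      simp only [Finset.mem_insert, Finset.mem_singleton, not_or] at hk'
      have := hcon k hk'.1 hk'.2
      have := (Finset.mem_filter.1 hk).2
      omega
    have hcard := (Finset.card_le_card hsub).trans Finset.card_le_two
    rcases hs with ⟨h1, h2⟩ | h1
    · rw [Finset.filter_true_of_mem] at hcard
      · simp at hcard; omega
      · rintro (_ | k) _
        · simp only [Option.elim_none]; omega
        · exact hm k
    · have hsub' : Finset.univ.map Embedding.some ⊆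
          Finset.univ.filter fun k : Option (Fin s) => 0 < k.elim (h - 1) m := by
        intro k hk
        obtain ⟨i, -, rfl⟩ := Finset.mem_map.1 hk
        exact Finset.mem_filter.2 ⟨Finset.mem_univ _, hm i⟩
      have := (Finset.card_le_card hsub').trans hcard
      simp at this
      omega

theorem reachable_of_card_eq_one [Fintype W] (hh : 0 < h) (hW : Fintype.card W = 1)
    (p q : Position W h m) : (graph W h m).Reachable p q := by
  obtain ⟨a, ha⟩ := Fintype.card_eq_one_iff.1 hW
  have key : ∀ p : Position W h m, ∃ p' : Position W h m,
      p'.toStacks = update (fun _ => []) none [a] ∧ (graph W h m).Reachable p p' := by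
    intro p
    obtain ⟨i, hi⟩ := p.exists_mem_toStacks a
    obtain ⟨b, l, hbl⟩ := List.exists_cons_of_ne_nil (List.ne_nil_of_mem hi)
    obtain rfl := ha b
    have hp : p.toStacks = update (update p.toStacks i l) i (b :: update p.toStacks i l i) := by
      simp [← hbl]
    have hcard := p.card_content_toStacks
    rw [hp, content_update_cons, Multiset.card_cons, hW] at hcard
    rw [eq_nil_of_card_content_eq_zero (T := update p.toStacks i l) (by omega)] at hp
    exact p.exists_reachable_headshunt hh hp (by simp)
  obtain ⟨p', hp', rp⟩ := key p
  obtain ⟨q', hq', rq⟩ := key q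
  rw [toStacks_injective (hq'.trans hp'.symm)] at rq
  exact rp.trans rq.symm

end Inglenook

/-! ### Necessity: invariant wagons. -/

namespace Inglenook

variable {W : Type*} {s : ℕ} {h : ℕ} {m : Fin s → ℕ}

/-- An invariant wagon `e` decides the last wagon of siding `z` against some permutation of any
starting position. -/
theorem not_alwaysSolvable_of_invariant [Nontrivial W] {S F : Set (Position W h m)}
    (hS : S.Nonempty) (hSnat : IsNaturalStart S) {z : Fin s} {ω : W}
    (hF : ∀ p ∈ F, (p.siding z).getLast? = some ω) (e : Position W h m → Option W)
    (hmove : ∀ p q, IsMove p q → e p = e q) (hperm : ∀ (p : Position W h m) (σ : Equiv.Perm W), e (p.permute σ) = (e p).map σ)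
    (hne : ∀ p, e p ≠ none)
    (hz : (∀ p : Position W h m, (p.siding z).getLast? = some ω → e p = some ω) ∨
      ∀ p : Position W h m, (p.siding z).getLast? = some ω → e p ≠ some ω) :
    ¬ AlwaysSolvable S F := by
  classical
  intro hsol
  obtain ⟨p, hp⟩ := hS
  obtain ⟨a, ha⟩ := Option.ne_none_iff_exists'.1 (hne p)
  -- Swapping `a` and `b` in the start makes `b` the invariant wagon.
  have key : ∀ b, ∃ q ∈ F, e q = some b := by
    intro b
    obtain ⟨q, hq, hr⟩ := hsol _ (hSnat p hp (Equiv.swap a b))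
    refine ⟨q, hq, ?_⟩
    have hinv : e (p.permute (Equiv.swap a b)) = e q := by
      clear hq
      rw [SimpleGraph.reachable_iff_reflTransGen] at hr
      induction hr with
      | refl => rfl
      | tail _ hadj ih => exact ih.trans (hmove _ _ hadj)
    rw [← hinv, hperm, ha, Option.map_some, Equiv.swap_apply_left]
  rcases hz with hz | hz
  · obtain ⟨b, hb⟩ := exists_ne ω
    obtain ⟨q, hq, hqb⟩ := key b
    rw [hz q (hF q hq)] at hqb
    exact hb (Option.some.inj hqb).symm
  · obtain ⟨q, hq, hqb⟩ := key ω
    exact hz q (hF q hq) hqb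

section Necessity

variable [Nontrivial W] {S F : Set (Position W h m)} (hS : S.Nonempty) (hSnat : IsNaturalStart S)
  (hFnat : IsNaturalFinish F)

include hS hSnat hFnat

/-- The headshunt can never be emptied, so the wagon next to the engine stays there. -/
theorem not_alwaysSolvable_of_sum_lt [Fintype W] (hlt : ∑ i, m i < Fintype.card W) :
    ¬ AlwaysSolvable S F := by
  obtain ⟨z, ω, hF⟩ := hFnat
  have hpos : ∀ p : Position W h m, p.headshunt ≠ [] := by
    intro p hp
    have h1 := p.length_add_sum_length
    have h2 := Finset.sum_le_sum (s := Finset.univ) fun i _ => p.siding_length_le i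
    simp [hp] at h1
    omega
  refine not_alwaysSolvable_of_invariant hS hSnat hF (fun p => p.headshunt.head?) ?_ ?_ ?_
    (Or.inr ?_)
  · rintro p q ⟨-, r, -, hr⟩
    rw [← List.head?_append_of_ne_nil _ (hpos p), hr, List.head?_append_of_ne_nil _ (hpos q)]
  · intro p σ
    simp [Position.permute]
  · intro p
    simpa using hpos p
  · intro p hp hp'
    exact p.headshunt_disjoint z (List.mem_of_mem_head? hp') (List.mem_of_getLast? hp)

/-- Siding `j` can be empty only when all other places are full. Then the sole moves push wagons
back into `j`, and the wagon that left it last returns to its buffer stop. -/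
theorem not_alwaysSolvable_of_add_sum_le [Fintype W] (hh : 0 < h) (j : Fin s)
    (hle : h + ∑ i, m i ≤ Fintype.card W + m j) : ¬ AlwaysSolvable S F := by
  obtain ⟨z, ω, hF⟩ := hFnat
  have hfull : ∀ p : Position W h m, p.siding j = [] →
      p.headshunt.length = h ∧ ∀ i, i ≠ j → (p.siding i).length = m i := by
    intro p hp
    have h1 := p.length_add_sum_length
    rw [← Finset.add_sum_erase _ _ (Finset.mem_univ j), hp, List.length_nil] at h1
    rw [← Finset.add_sum_erase _ m (Finset.mem_univ j)] at hle
    have h0 := p.headshunt_length_le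
    have h2 : ∀ i ∈ Finset.univ.erase j, (p.siding i).length ≤ m i :=
      fun i _ => p.siding_length_le i
    have h3 := Finset.sum_le_sum h2
    refine ⟨by omega, fun i hi => ?_⟩
    exact (Finset.sum_eq_sum_iff_of_le h2).1 (by omega) i
      (Finset.mem_erase.2 ⟨hi, Finset.mem_univ i⟩)
  refine not_alwaysSolvable_of_invariant hS hSnat hF
    (fun p => (p.headshunt ++ p.siding j).getLast?) ?_ ?_ ?_ ?_
  · rintro p q ⟨hne, r, hi, hr⟩
    by_cases hrj : r = j
    · rw [← hrj, hr]
    have hpq := hi j (Ne.symm hrj)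
    by_cases hj : p.siding j = []
    · refine absurd (Position.ext ?_ (funext fun i => ?_)) hne
      · exact (List.append_inj hr ((hfull p hj).1.trans (hfull q (hpq ▸ hj)).1.symm)).1
      · by_cases hir : i = r
        · subst hir
          exact (List.append_inj hr ((hfull p hj).1.trans (hfull q (hpq ▸ hj)).1.symm)).2
        · exact hi i hir
    · rw [List.getLast?_append_of_ne_nil _ hj, List.getLast?_append_of_ne_nil _ (hpq ▸ hj), hpq]
  · intro p σ
    simp only [Position.permute, ← List.map_append, List.getLast?_map]
  · intro p hp
    rw [List.getLast?_eq_none_iff, List.append_eq_nil_iff] at hp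
    have := (hfull p hp.2).1
    rw [hp.1, List.length_nil] at this
    omega
  · by_cases hzj : z = j
    · subst hzj
      refine Or.inl fun p hp => ?_
      rw [List.getLast?_append, hp]
      rfl
    · refine Or.inr fun p hp hp' => ?_
      rcases List.mem_append.1 (List.mem_of_getLast? hp') with h1 | h1
      · exact p.headshunt_disjoint z h1 (List.mem_of_getLast? hp)
      · exact p.siding_disjoint z j hzj (List.mem_of_getLast? hp) h1

/-- With one siding, or with two sidings and a headshunt of length one, the order of the wagons along
the track never changes. -/
theorem not_alwaysSolvable_of_le_two (hs : s ≤ 1 ∨ (s ≤ 2 ∧ h ≤ 1)) : ¬ AlwaysSolvable S F := by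
  obtain ⟨z, ω, hF⟩ := hFnat
  -- A headshunt with at most one wagon reads the same from either end, so two sidings and the
  -- headshunt form one line.
  have hrev : ∀ p : Position W h m, h ≤ 1 → p.headshunt.reverse = p.headshunt := by
    intro p hh
    have := p.headshunt_length_le.trans hh
    match p.headshunt, this with
    | [], _ => rfl
    | [a], _ => rfl
  by_cases hz1 : ∀ i, i = z
  · refine not_alwaysSolvable_of_invariant hS hSnat hF
      (fun p => (p.headshunt ++ p.siding z).getLast?) ?_ ?_ ?_ (Or.inl fun p hp => ?_)
    · rintro p q ⟨-, r, -, hr⟩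
      rw [← hz1 r, hr]
    · intro p σ
      simp only [Position.permute, ← List.map_append, List.getLast?_map]
    · intro p hp
      rw [List.getLast?_eq_none_iff, List.append_eq_nil_iff] at hp
      rcases p.cover ω with h1 | ⟨i, h1⟩
      · simp [hp.1] at h1
      · rw [hz1 i, hp.2] at h1
        simp at h1
    · rw [List.getLast?_append, hp]
      rfl
  · push Not at hz1
    obtain ⟨o, hoz⟩ := hz1
    have hs2 : s ≤ 2 ∧ h ≤ 1 := hs.resolve_left (by omega)
    have ho : ∀ i, i = z ∨ i = o := by omega
    refine not_alwaysSolvable_of_invariant hS hSnat hF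
      (fun p => ((p.siding o).reverse ++ p.headshunt ++ p.siding z).getLast?) ?_ ?_ ?_
      (Or.inl fun p hp => ?_)
    · rintro p q ⟨-, r, hi, hr⟩
      rcases ho r with rfl | rfl
      · rw [List.append_assoc, hr, hi o hoz, List.append_assoc]
      · rw [← hrev p hs2.2, ← hrev q hs2.2, ← List.reverse_append, ← List.reverse_append, hr,
          hi z (Ne.symm hoz)]
    · intro p σ
      simp only [Position.permute, ← List.map_append, ← List.map_reverse, List.getLast?_map]
    · intro p hp
      simp only [List.getLast?_eq_none_iff, List.append_eq_nil_iff, List.reverse_eq_nil_iff] at hp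
      rcases p.cover ω with h1 | ⟨i, h1⟩
      · simp [hp.1.2] at h1
      · rcases ho i with rfl | rfl
        · simp [hp.2] at h1
        · simp [hp.1.1] at h1
    · rw [List.getLast?_append, hp]
      rfl

end Necessity

end Inglenook

theorem mainTheorem1 {W : Type*} [Fintype W] (w s h : ℕ) (m : Fin s → ℕ)
    (hW : Fintype.card W = w) (hw : 0 < w) (hs : 0 < s) (hh : 0 < h) (hm : ∀ i, 0 < m i)
    (hlt : w < h + ∑ i, m i)
    (S F : Set (Inglenook.Position W h m)) (hS : S.Nonempty) (hF : F.Nonempty)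
    (hSnat : Inglenook.IsNaturalStart S) (hFnat : Inglenook.IsNaturalFinish F) :
    Inglenook.AlwaysSolvable S F ↔
      w = 1 ∨
      (1 < w ∧ 1 < s ∧ 1 < h ∧ Inglenook.MainCondition w h m) ∨
      (1 < w ∧ 2 < s ∧ h = 1 ∧ Inglenook.MainCondition w h m) := by
  subst hW
  constructor
  · intro hsol
    by_contra hcon
    have hw2 : 1 < Fintype.card W := by omega
    have : Nontrivial W := Fintype.one_lt_card_iff_nontrivial.1 hw2
    by_cases hc : Inglenook.MainCondition (Fintype.card W) h m
    · exact Inglenook.not_alwaysSolvable_of_le_two hS hSnat hFnat (by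
        simp only [hc, hw2, true_and, and_true] at hcon
        omega) hsol
    · unfold Inglenook.MainCondition at hc
      -- When (*) fails, either `h - 1` attains the maximum and the sidings cannot hold all wagons,
      -- or a longest siding `j` does.
      obtain ⟨j, -, hj⟩ := Finset.exists_mem_eq_sup Finset.univ ⟨⟨0, hs⟩, Finset.mem_univ _⟩ m
      rw [hj] at hc
      by_cases h1 : ∑ i, m i < Fintype.card W
      · exact Inglenook.not_alwaysSolvable_of_sum_lt hS hSnat hFnat h1 hsol
      · exact Inglenook.not_alwaysSolvable_of_add_sum_le hS hSnat hFnat hh j (by omega) hsol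
  · intro hcond p _
    obtain ⟨q, hq⟩ := hF
    refine ⟨q, hq, ?_⟩
    rcases hcond with h1 | ⟨-, h1, h2, h3⟩ | ⟨-, h1, -, h3⟩
    · exact Inglenook.reachable_of_card_eq_one hh h1 p q
    · exact Inglenook.reachable_of_mainCondition hh hm (Or.inl ⟨h1, h2⟩) h3 p q
    · exact Inglenook.reachable_of_mainCondition hh hm (Or.inr h1) h3 p q
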